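/- **Setting.** Let $d\ge 0$ and let $P,Q$ be probability measures on $\mathbb R^d$ with Lebesgue densities $p,q$. A *test* is a measurable function $g:\mathbb R^d\to[0,1]$, where $g(x)$ is the probability of rejecting $H_0:X\sim P$ in favour of $H_1:X\sim Q$ after observing $x$; its errors are $\alpha^{(g)}=\int g\,dP$ and $\beta^{(g)}=\int(1-g)\,dQ$. The *optimal trade-off curve* is $$T(\alpha)=\inf\{\beta^{(g)}: g\text{ a test with }\alpha^{(g)}\le\alpha\},\qquad \alpha\in[0,1].$$ For probability densities $\hat p,\hat q$ and $h>0$, the *perturbed likelihood-ratio test* with threshold $\eta\in\mathbb R$ rejects $H_0$ if $\hat q(X)/\hat p(X)>\eta+hU$, where $U$ is uniform on $[-1/2,1/2]$ and independent of $X$ (the ratio is $+\infty$ where $\hat p=0<\hat q$). Its errors under $(\hat p,\hat q)$ are $$\hat\alpha_h(\eta)=\int_{-h/2}^{h/2}\frac1h\int_{\{\hat q/\hat p>\eta+x\}}\hat p(y)\,dy\,dx,\qquad \hat\beta_h(\eta)=\int_{-h/2}^{h/2}\frac1h\int_{\{\hat q/\hat p\le\eta+x\}}\hat q(y)\,dy\,dx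 .$$ Its trade-off curve $\hat T_h:[0,1]\to[0,1]$ is defined by $\hat T_h(\hat\alpha_h(\eta))=\hat\beta_h(\eta)$ for $\eta\in\mathbb R$ (this is consistent, and every $\alpha\in(0,1]$ is of the form $\hat\alpha_h(\eta)$); if $\alpha=0$ is not of this form, then $\hat T_h(0):=\lim_{\eta\to\infty}\hat\beta_h(\eta)$. **Theorem.** Assume: 1. $p$ and $q$ are continuous, and there are only finitely many $\eta\ge0$ for which the set $\{q/p=\eta\}$ has positive $P$-mass. 2. For every $n\in\mathbb N$, $\hat p=\hat p_n$ and $\hat q=\hat q_n$ are random functions on $\mathbb R^d$ that are continuous probability densities and tend to $0$ at infinity, and for a sequence $a_n\ge0$ with $a_n\to0$, $$\Pr\Big[\sup_x|\hat p_n(x)-p(x)|>a_n\Big]\to0,\qquad \Pr\Big[\sup_x|\hat q_n(x)-q(x)|>a_n\Big]\to0 .$$ 3. $h_n>0$, $h_n\to0$ and $h_n/a_n\to\infty$ (with $h_n/a_n=\infty$ if $a_n=0$). Let $\hat T_{h_n}$ be the trade-off curve of the perturbed likelihood-ratio test built from $\hat p_n,\hat q_n$ with $h=h_n$. If the likelihood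 ratio $q/p$ is finite $Q$-almost surely (that is, $Q\ll P$), then $$\sup_{\alpha\in[0,1]}|\hat T_{h_n}(\alpha)-T(\alpha)|\longrightarrow0\quad\text{in probability as }n\to\infty .$$ Without the condition $Q\ll P$, it still holds for every $\delta>0$ that $\sup_{\alpha\in[\delta,1]}|\hat T_{h_n}(\alpha)-T(\alpha)|\to0$ in probability. -/

import Mathlib

open MeasureTheory Filter Topology
open scoped ENNReal NNReal

/-- `ℝ^d` with its Euclidean norm and Lebesgue measure `volume`. -/
abbrev Rd (d : ℕ) : Type := EuclideanSpace ℝ (Fin d)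

/-- A continuous probability density on `ℝ^d`. -/
structure IsContinuousDensity {d : ℕ} (f : Rd d → ℝ) : Prop where
  continuous : Continuous f
  nonneg : ∀ y, 0 ≤ f y
  integrable : Integrable f
  integral_eq_one : ∫ y, f y = 1

/-- The measure on `ℝ^d` with Lebesgue density `f`. -/
noncomputable def densityMeasure {d : ℕ} (f : Rd d → ℝ) : Measure (Rd d) :=
  volume.withDensity fun y => ENNReal.ofReal (f y)

/-! ### Tests and the optimal trade-off curve -/

/-- A (possibly randomized) test: `g y` is the probability of rejecting `H₀` after observing `y`. -/
structure IsRandomizedTest {X : Type*} [MeasurableSpace X] (g : X → ℝ) : Prop where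
  measurable : Measurable g
  nonneg : ∀ y, 0 ≤ g y
  le_one : ∀ y, g y ≤ 1

/-- Type-I error of a test: the probability under `P` of rejecting. -/
noncomputable def typeIError {X : Type*} [MeasurableSpace X] (P : Measure X) (g : X → ℝ) : ℝ :=
  ∫ y, g y ∂P

/-- Type-II error of a test: the probability under `Q` of not rejecting. -/
noncomputable def typeIIError {X : Type*} [MeasurableSpace X] (Q : Measure X) (g : X → ℝ) : ℝ :=
  ∫ y, (1 - g y) ∂Q

/-- The optimal trade-off curve
`T(α) = inf {type-II error of g : g a test with type-I error at most α}`. -/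
noncomputable def tradeoff {X : Type*} [MeasurableSpace X] (P Q : Measure X) (α : ℝ) : ℝ :=
  sInf {b : ℝ | ∃ g : X → ℝ, IsRandomizedTest g ∧ typeIError P g ≤ α ∧ b = typeIIError Q g}

/-! ### The perturbed likelihood-ratio test -/

/-- The likelihood ratio `q / p`, equal to `∞` where `p = 0 < q`. (Where `p = q = 0` its value is
irrelevant, as this set has mass zero under both densities.) -/
noncomputable def likelihoodRatio {d : ℕ} (p q : Rd d → ℝ) (y : Rd d) : ℝ≥0∞ :=
  ENNReal.ofReal (q y) / ENNReal.ofReal (p y)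

/-- The rejection region `{q / p > t}`; the real threshold `t` may be negative. -/
def rejectionRegion {d : ℕ} (p q : Rd d → ℝ) (t : ℝ) : Set (Rd d) :=
  {y | (t : EReal) < (likelihoodRatio p q y : EReal)}

/-- The acceptance region `{q / p ≤ t}`. -/
def acceptanceRegion {d : ℕ} (p q : Rd d → ℝ) (t : ℝ) : Set (Rd d) :=
  {y | (likelihoodRatio p q y : EReal) ≤ (t : EReal)}

/-- Type-I error, for the null density `p`, of the test that rejects if `q / p > η + h U` with `U`
uniform on `[-1/2, 1/2]`:  `∫_{x ∈ [-h/2, h/2]} (1/h) ∫_{q/p > η + x} p`. -/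
noncomputable def perturbedAlpha {d : ℕ} (p q : Rd d → ℝ) (h η : ℝ) : ℝ :=
  ∫ x in Set.Icc (-h / 2) (h / 2), (1 / h) * ∫ y in rejectionRegion p q (η + x), p y

/-- Type-II error, for the alternative density `q`, of the same test:
`∫_{x ∈ [-h/2, h/2]} (1/h) ∫_{q/p ≤ η + x} q`. -/
noncomputable def perturbedBeta {d : ℕ} (p q : Rd d → ℝ) (h η : ℝ) : ℝ :=
  ∫ x in Set.Icc (-h / 2) (h / 2), (1 / h) * ∫ y in acceptanceRegion p q (η + x), q y

/-- The trade-off curve of the perturbed likelihood-ratio test, i.e. the curve that takes the value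
`perturbedBeta p q h η` at `perturbedAlpha p q h η`; see `perturbedTradeoff_perturbedAlpha`, which
says that it passes through all these points (in particular that they lie on the graph of a
function).

Every `α ∈ (0, 1]` is of the form `perturbedAlpha p q h η` with `η` real. The value `α = 0` need not
be, since it may correspond to `η = ∞`; there the supremum below is the limit of
`perturbedBeta p q h η` for `η → ∞`, so that the curve is extended by continuity. -/
noncomputable def perturbedTradeoff {d : ℕ} (p q : Rd d → ℝ) (h α : ℝ) : ℝ :=
  sSup {b : ℝ | ∃ η : ℝ, α ≤ perturbedAlpha p q h η ∧ b = perturbedBeta p q h η}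

theorem measurable_likelihoodRatio {d : ℕ} {p q : Rd d → ℝ} (hp : IsContinuousDensity p)
    (hq : IsContinuousDensity q) : Measurable (likelihoodRatio p q) :=
  (ENNReal.measurable_ofReal.comp hq.continuous.measurable).div
    (ENNReal.measurable_ofReal.comp hp.continuous.measurable)

theorem measurableSet_rejectionRegion {d : ℕ} {p q : Rd d → ℝ} (hp : IsContinuousDensity p)
    (hq : IsContinuousDensity q) (t : ℝ) : MeasurableSet (rejectionRegion p q t) :=
  measurableSet_lt measurable_const (measurable_likelihoodRatio hp hq).coe_ereal_ennreal

theorem acceptanceRegion_eq_compl {d : ℕ} (p q : Rd d → ℝ) (t : ℝ) :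
    acceptanceRegion p q t = (rejectionRegion p q t)ᶜ := by
  ext y; simp [acceptanceRegion, rejectionRegion]

theorem rejectionRegion_anti {d : ℕ} (p q : Rd d → ℝ) {s t : ℝ} (hst : s ≤ t) :
    rejectionRegion p q t ⊆ rejectionRegion p q s := fun _ hy =>
  lt_of_le_of_lt (EReal.coe_le_coe_iff.2 hst) hy

theorem antitone_setIntegral_rejectionRegion {d : ℕ} {p q : Rd d → ℝ}
    (hp : IsContinuousDensity p) :
    Antitone fun t => ∫ y in rejectionRegion p q t, p y := fun _ _ hst =>
  setIntegral_mono_set hp.integrable.integrableOn (ae_of_all _ hp.nonneg)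
    (rejectionRegion_anti p q hst).eventuallyLE

theorem monotone_setIntegral_acceptanceRegion {d : ℕ} {p q : Rd d → ℝ}
    (hq : IsContinuousDensity q) :
    Monotone fun t => ∫ y in acceptanceRegion p q t, q y := fun s t hst =>
  setIntegral_mono_set hq.integrable.integrableOn (ae_of_all _ hq.nonneg) (by
    rw [acceptanceRegion_eq_compl, acceptanceRegion_eq_compl]
    exact (Set.compl_subset_compl.2 (rejectionRegion_anti p q hst)).eventuallyLE)

/-- Two thresholds with the same `p`-mass above them have the same `q`-mass below them. -/
theorem setIntegral_acceptanceRegion_eq {d : ℕ} {p q : Rd d → ℝ} (hp : IsContinuousDensity p)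
    (hq : IsContinuousDensity q) {s t : ℝ} (hst : s ≤ t)
    (h : ∫ y in rejectionRegion p q s, p y = ∫ y in rejectionRegion p q t, p y) :
    ∫ y in acceptanceRegion p q s, q y = ∫ y in acceptanceRegion p q t, q y := by
  have hms := measurableSet_rejectionRegion hp hq s
  have hmt := measurableSet_rejectionRegion hp hq t
  have hsub := rejectionRegion_anti p q hst
  have h0 : ∫ y in rejectionRegion p q s \ rejectionRegion p q t, p y = 0 := by
    rw [setIntegral_sdiff hmt hp.integrable.integrableOn hsub, h, sub_self]
  have hp0 : ∀ᵐ y, y ∈ rejectionRegion p q s \ rejectionRegion p q t → p y = 0 := by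
    rw [setIntegral_eq_zero_iff_of_nonneg_ae (ae_of_all _ hp.nonneg)
      hp.integrable.integrableOn] at h0
    exact (ae_restrict_iff' (hms.diff hmt)).1 h0
  have hq0 : ∫ y in rejectionRegion p q s \ rejectionRegion p q t, q y = 0 := by
    apply setIntegral_eq_zero_of_ae_eq_zero
    filter_upwards [hp0] with y hy hmem
    have hpy := hy hmem
    by_contra hne
    have hpos : 0 < q y := lt_of_le_of_ne (hq.nonneg y) (Ne.symm hne)
    apply hmem.2
    have : likelihoodRatio p q y = ⊤ := by
      simp [likelihoodRatio, hpy, ENNReal.div_zero, hpos]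
    simp [rejectionRegion, this]
  rw [setIntegral_sdiff hmt hq.integrable.integrableOn hsub] at hq0
  have e1 := integral_add_compl hms hq.integrable
  have e2 := integral_add_compl hmt hq.integrable
  rw [acceptanceRegion_eq_compl, acceptanceRegion_eq_compl]
  linarith

theorem integrableOn_rejection {d : ℕ} {p q : Rd d → ℝ} (hp : IsContinuousDensity p) (h η : ℝ) :
    IntegrableOn (fun x => (1 / h) * ∫ y in rejectionRegion p q (η + x), p y)
      (Set.Icc (-h / 2) (h / 2)) := by
  have : Antitone fun x => ∫ y in rejectionRegion p q (η + x), p y := fun a b hab =>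
    antitone_setIntegral_rejectionRegion (q := q) hp (by linarith)
  exact ((this.antitoneOn _).integrableOn_isCompact isCompact_Icc).const_mul _

theorem integrableOn_acceptance {d : ℕ} {p q : Rd d → ℝ} (hq : IsContinuousDensity q) (h η : ℝ) :
    IntegrableOn (fun x => (1 / h) * ∫ y in acceptanceRegion p q (η + x), q y)
      (Set.Icc (-h / 2) (h / 2)) := by
  have : Monotone fun x => ∫ y in acceptanceRegion p q (η + x), q y := fun a b hab =>
    monotone_setIntegral_acceptanceRegion (p := p) hq (by linarith)
  exact ((this.monotoneOn _).integrableOn_isCompact isCompact_Icc).const_mul _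

/-- The defining property of the curve: its value at `perturbedAlpha p q h η` is
`perturbedBeta p q h η`. -/
theorem perturbedTradeoff_perturbedAlpha {d : ℕ} {p q : Rd d → ℝ} (hp : IsContinuousDensity p)
    (hq : IsContinuousDensity q) {h : ℝ} (hh : 0 < h) (η : ℝ) :
    perturbedTradeoff p q h (perturbedAlpha p q h η) = perturbedBeta p q h η := by
  refine IsGreatest.csSup_eq ⟨⟨η, le_rfl, rfl⟩, ?_⟩
  rintro b ⟨η', hle, rfl⟩
  have hh' : 0 ≤ 1 / h := by positivity
  rcases le_total η' η with hη | hη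
  · refine integral_mono (integrableOn_acceptance hq h η') (integrableOn_acceptance hq h η) ?_
    intro x
    exact mul_le_mul_of_nonneg_left
      (monotone_setIntegral_acceptanceRegion (p := p) hq (by linarith)) hh'
  · have hfg : ∀ x, (1 / h) * ∫ y in rejectionRegion p q (η' + x), p y ≤
        (1 / h) * ∫ y in rejectionRegion p q (η + x), p y := fun x =>
      mul_le_mul_of_nonneg_left
        (antitone_setIntegral_rejectionRegion (q := q) hp (by linarith)) hh'
    have heq : perturbedAlpha p q h η' = perturbedAlpha p q h η :=
      le_antisymm (integral_mono (integrableOn_rejection hp h η')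
        (integrableOn_rejection hp h η) hfg) hle
    have hae := (integral_eq_iff_of_ae_le (integrableOn_rejection hp h η')
      (integrableOn_rejection hp h η) (ae_of_all _ hfg)).1 heq
    refine le_of_eq (integral_congr_ae ?_)
    filter_upwards [hae] with x hx
    have hx' := mul_left_cancel₀ (by positivity : (1 / h) ≠ 0) hx
    rw [setIntegral_acceptanceRegion_eq hp hq (by linarith) hx'.symm]

/-- Convergence to zero in probability of a sequence of `[0, ∞]`-valued random variables,
`X_n = o_P(1)`: for all `ε > 0` the probability of `X_n > ε` tends to `0`. -/
def IsLittleOInProbability {Ω : Type*} [MeasurableSpace Ω] (Pr : Measure Ω)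
    (X : ℕ → Ω → ℝ≥0∞) : Prop :=
  ∀ ε : ℝ, 0 < ε → Tendsto (fun n => Pr {ω | ENNReal.ofReal ε < X n ω}) atTop (𝓝 0)

/-!
The proof compares the two curves directly, through Lagrange multipliers, and is quantitative. Let
`e_p`, `e_q` be the `L¹`-distances between the estimated and the true densities.

* Both densities have integral one, so `e_p ≤ 2 ∫ min(p, κ)` whenever the uniform distance is at
  most `κ`; this tends to zero with `κ` by dominated convergence
  (`IsContinuousDensity.integral_abs_sub_le`, `IsContinuousDensity.tendsto_integral_min`).
* By Fubini the perturbed test is an ordinary randomized test (`perturbedTest`). Under `(P, Q)` its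
  errors differ from the nominal ones by at most `e_p` and `e_q`. Scaling it down to the exact level
  costs at most `e_p / δ` on `[δ, 1]`. So the optimal curve lies below the perturbed one, up to
  these errors (`tradeoff_le_perturbedTradeoff_add`). That every level `α ∈ (0, 1]` is attained uses
  the continuity of `η ↦ perturbedAlpha`, which holds because `h > 0`.
* As in the Neyman–Pearson lemma, the perturbed test with threshold `η` minimizes
  `type-II + η * type-I` under the estimated densities, up to `h / 2` (`perturbedBeta_add_le`). At
  levels at least `δ`, Markov's inequality gives `η ≤ 1 / δ + h / 2`, so comparison with an arbitrary
  test of level `α` bounds the perturbed curve by the optimal one, up to a constant depending on `δ`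
  times the errors (`perturbedTradeoff_le_tradeoff_add`).

This is uniform convergence on `[δ, 1]`. If `Q ≪ P`, the optimal curve tends to `1` at `0`
(`exists_one_sub_le_tradeoff`), and since both curves are antitone and at most `1`, the convergence
extends to `[0, 1]`.
-/

/-! ### Integrals against densities -/

theorem integral_densityMeasure {d : ℕ} {f : Rd d → ℝ} (hf : IsContinuousDensity f)
    (g : Rd d → ℝ) : ∫ y, g y ∂densityMeasure f = ∫ y, g y * f y := by
  rw [densityMeasure, integral_withDensity_eq_integral_toReal_smul
    (f := fun y => ENNReal.ofReal (f y))
    (ENNReal.measurable_ofReal.comp hf.continuous.measurable) (ae_of_all _ fun _ => by simp)]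
  simp [ENNReal.toReal_ofReal (hf.nonneg _), mul_comm]

theorem IsRandomizedTest.integrable_mul {d : ℕ} {f g : Rd d → ℝ} (hg : IsRandomizedTest g)
    (hf : Integrable f) : Integrable fun y => g y * f y :=
  hf.bdd_mul (c := 1) hg.measurable.aestronglyMeasurable (ae_of_all _ fun y => by
    rw [Real.norm_eq_abs, abs_of_nonneg (hg.nonneg y)]; exact hg.le_one y)

theorem typeIIError_densityMeasure {d : ℕ} {f g : Rd d → ℝ} (hf : IsContinuousDensity f)
    (hg : IsRandomizedTest g) :
    typeIIError (densityMeasure f) g = 1 - ∫ y, g y * f y := by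
  rw [typeIIError, integral_densityMeasure hf]
  simp_rw [sub_mul, one_mul]
  rw [integral_sub hf.integrable (hg.integrable_mul hf.integrable), hf.integral_eq_one]

theorem IsRandomizedTest.integral_mul_nonneg {d : ℕ} {f g : Rd d → ℝ} (hg : IsRandomizedTest g)
    (hf : IsContinuousDensity f) : 0 ≤ ∫ y, g y * f y :=
  integral_nonneg fun y => mul_nonneg (hg.nonneg y) (hf.nonneg y)

theorem IsRandomizedTest.integral_mul_le_one {d : ℕ} {f g : Rd d → ℝ} (hg : IsRandomizedTest g)
    (hf : IsContinuousDensity f) : ∫ y, g y * f y ≤ 1 := by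
  rw [← hf.integral_eq_one]
  exact integral_mono (hg.integrable_mul hf.integrable) hf.integrable fun y =>
    mul_le_of_le_one_left (hf.nonneg y) (hg.le_one y)

/-- The rejection probabilities of a test under two densities differ by at most their
`L¹`-distance. -/
theorem IsRandomizedTest.abs_integral_mul_sub_le {d : ℕ} {f f' g : Rd d → ℝ}
    (hg : IsRandomizedTest g) (hf : IsContinuousDensity f) (hf' : IsContinuousDensity f') :
    |(∫ y, g y * f' y) - ∫ y, g y * f y| ≤ ∫ y, |f' y - f y| := by
  rw [← integral_sub (hg.integrable_mul hf'.integrable) (hg.integrable_mul hf.integrable)]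
  refine (abs_integral_le_integral_abs).trans (integral_mono
    ((hg.integrable_mul hf'.integrable).sub (hg.integrable_mul hf.integrable)).abs
    (hf'.integrable.sub hf.integrable).abs fun y => ?_)
  simp only
  rw [← mul_sub, abs_mul, abs_of_nonneg (hg.nonneg y)]
  exact mul_le_of_le_one_left (abs_nonneg _) (hg.le_one y)

theorem IsContinuousDensity.integrable_min {d : ℕ} {f : Rd d → ℝ} (hf : IsContinuousDensity f)
    {κ : ℝ} (hκ : 0 ≤ κ) : Integrable fun y => min (f y) κ :=
  hf.integrable.mono (hf.continuous.min continuous_const).aestronglyMeasurable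
    (ae_of_all _ fun y => by
      rw [Real.norm_of_nonneg (le_min (hf.nonneg y) hκ), Real.norm_of_nonneg (hf.nonneg y)]
      exact min_le_left _ _)

/-- A quantitative form of Scheffé's lemma: two densities have the same integral, so their
`L¹`-distance is twice the integral of the positive part of `f - f'`, and that positive part is at
most `f` as well as at most the uniform distance. -/
theorem IsContinuousDensity.integral_abs_sub_le {d : ℕ} {f f' : Rd d → ℝ}
    (hf : IsContinuousDensity f) (hf' : IsContinuousDensity f') {κ : ℝ} (hκ : 0 ≤ κ)
    (hff' : ∀ y, |f' y - f y| ≤ κ) : ∫ y, |f' y - f y| ≤ 2 * ∫ y, min (f y) κ := by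
  have hdiff : Integrable fun y => f' y - f y := hf'.integrable.sub hf.integrable
  have h0 : ∫ y, (f' y - f y) = 0 := by
    rw [integral_sub hf'.integrable hf.integrable, hf.integral_eq_one, hf'.integral_eq_one,
      sub_self]
  have h1 : ∫ y, (|f' y - f y| - (f' y - f y)) ≤ ∫ y, 2 * min (f y) κ := by
    refine integral_mono (hdiff.abs.sub hdiff) ((hf.integrable_min hκ).const_mul 2) fun y => ?_
    have h2 := hff' y
    have h3 := hf'.nonneg y
    have h4 := hf.nonneg y
    simp only
    rcases abs_cases (f' y - f y) with ⟨ha, _⟩ | ⟨ha, _⟩ <;> rw [ha] at h2 ⊢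
    · have := le_min h4 hκ
      linarith
    · have : f y - f' y ≤ min (f y) κ := le_min (by linarith) (by linarith)
      linarith
  rw [integral_sub hdiff.abs hdiff, h0, sub_zero, integral_const_mul] at h1
  exact h1

theorem IsContinuousDensity.tendsto_integral_min {d : ℕ} {f : Rd d → ℝ}
    (hf : IsContinuousDensity f) {a : ℕ → ℝ} (ha_nonneg : ∀ n, 0 ≤ a n)
    (ha : Tendsto a atTop (𝓝 0)) :
    Tendsto (fun n => ∫ y, min (f y) (a n)) atTop (𝓝 0) := by
  have := tendsto_integral_of_dominated_convergence (μ := volume)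
    (F := fun n y => min (f y) (a n)) (f := fun _ => (0 : ℝ)) f
    (fun n => (hf.integrable_min (ha_nonneg n)).aestronglyMeasurable) hf.integrable
    (fun n => ae_of_all _ fun y => by
      rw [Real.norm_of_nonneg (le_min (hf.nonneg y) (ha_nonneg n))]
      exact min_le_left _ _)
    (ae_of_all _ fun y => by
      have h1 := (tendsto_const_nhds (x := f y)).min ha
      rwa [min_eq_right (hf.nonneg y)] at h1)
  simpa using this

/-! ### The optimal trade-off curve -/

theorem tradeoff_le_typeIIError {X : Type*} [MeasurableSpace X] {P Q : Measure X} {α : ℝ}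
    {g : X → ℝ} (hg : IsRandomizedTest g) (hα : typeIError P g ≤ α) :
    tradeoff P Q α ≤ typeIIError Q g := by
  refine csInf_le ⟨0, ?_⟩ ⟨g, hg, hα, rfl⟩
  rintro b ⟨g', hg', -, rfl⟩
  exact integral_nonneg fun y => sub_nonneg.2 (hg'.le_one y)

theorem le_tradeoff {X : Type*} [MeasurableSpace X] {P Q : Measure X} {α c : ℝ} (hα : 0 ≤ α)
    (hc : ∀ g, IsRandomizedTest g → typeIError P g ≤ α → c ≤ typeIIError Q g) :
    c ≤ tradeoff P Q α := by
  refine le_csInf ⟨_, fun _ => 0, ⟨measurable_const, fun _ => le_rfl, fun _ => zero_le_one⟩,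
    by simpa [typeIError] using hα, rfl⟩ ?_
  rintro b ⟨g, hg, hgα, rfl⟩
  exact hc g hg hgα

theorem tradeoff_le_one {d : ℕ} {p q : Rd d → ℝ} (hq : IsContinuousDensity q) {α : ℝ}
    (hα : 0 ≤ α) : tradeoff (densityMeasure p) (densityMeasure q) α ≤ 1 := by
  have h0 : IsRandomizedTest fun _ : Rd d => (0 : ℝ) :=
    ⟨measurable_const, fun _ => le_rfl, fun _ => zero_le_one⟩
  refine (tradeoff_le_typeIIError h0 (by simpa [typeIError] using hα)).trans ?_
  rw [typeIIError_densityMeasure hq h0]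
  simp

/-- Scaling a test down reduces its type-I error proportionally; hence a test that exceeds the
level `α ≥ δ` by `e` still bounds the trade-off curve at `α`, up to `e / δ`. -/
theorem tradeoff_le_of_integral_le {d : ℕ} {p q g : Rd d → ℝ} (hp : IsContinuousDensity p)
    (hq : IsContinuousDensity q) (hg : IsRandomizedTest g) {α δ e : ℝ} (hδ : 0 < δ) (hδα : δ ≤ α)
    (he : 0 ≤ e) (hgα : ∫ y, g y * p y ≤ α + e) :
    tradeoff (densityMeasure p) (densityMeasure q) α ≤ 1 - (∫ y, g y * q y) + e / δ := by
  have hα : 0 < α := hδ.trans_le hδα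
  have hαe : 0 < α + e := by linarith
  set l := α / (α + e) with hl
  have hl0 : 0 ≤ l := by positivity
  have hl1 : l ≤ 1 := (div_le_one hαe).2 (by linarith)
  have hlg : IsRandomizedTest fun y => l * g y :=
    ⟨hg.measurable.const_mul l, fun y => mul_nonneg hl0 (hg.nonneg y),
      fun y => mul_le_one₀ hl1 (hg.nonneg y) (hg.le_one y)⟩
  have hI : typeIError (densityMeasure p) (fun y => l * g y) ≤ α := by
    rw [typeIError, integral_densityMeasure hp]
    simp_rw [mul_assoc]
    rw [integral_const_mul]
    calc l * ∫ y, g y * p y ≤ l * (α + e) := mul_le_mul_of_nonneg_left hgα hl0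
      _ = α := div_mul_cancel₀ _ hαe.ne'
  refine (tradeoff_le_typeIIError hlg hI).trans ?_
  rw [typeIIError_densityMeasure hq hlg]
  simp_rw [mul_assoc]
  rw [integral_const_mul]
  have h1 : 1 - l ≤ e / δ := by
    have : 1 - l = e / (α + e) := by rw [hl]; field_simp; ring
    rw [this]
    exact div_le_div_of_nonneg_left he hδ (by linarith)
  nlinarith [hg.integral_mul_nonneg hq, hg.integral_mul_le_one hq]

/-- If `Q ≪ P`, the trade-off curve tends to `1` at `0`: for every `K ≥ 0`, a test of size `δ` has
power at most `∫ (q - K p)⁺ + K δ`, and the integral vanishes as `K → ∞`. -/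
theorem exists_one_sub_le_tradeoff {d : ℕ} {p q : Rd d → ℝ} (hp : IsContinuousDensity p)
    (hq : IsContinuousDensity q) (hac : densityMeasure q ≪ densityMeasure p) {ε : ℝ}
    (hε : 0 < ε) :
    ∃ δ, 0 < δ ∧ δ ≤ 1 ∧ 1 - ε ≤ tradeoff (densityMeasure p) (densityMeasure q) δ := by
  have hq0 : ∀ᵐ y, p y = 0 → q y = 0 := by
    have hm : Measurable fun y => ENNReal.ofReal (q y) :=
      ENNReal.measurable_ofReal.comp hq.continuous.measurable
    have hm' : Measurable fun y => ENNReal.ofReal (p y) :=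
      ENNReal.measurable_ofReal.comp hp.continuous.measurable
    have h1 : ∀ᵐ y ∂densityMeasure q, ENNReal.ofReal (p y) ≠ 0 :=
      hac.ae_le ((ae_withDensity_iff hm').2 (ae_of_all _ fun y hy => hy))
    rw [densityMeasure, ae_withDensity_iff hm] at h1
    filter_upwards [h1] with y hy hpy
    by_contra hne
    exact hy (by simpa using lt_of_le_of_ne (hq.nonneg y) (Ne.symm hne)) (by simp [hpy])
  have hint : ∀ n : ℕ, Integrable fun y => max (q y - n * p y) 0 := fun n =>
    (hq.integrable.sub (hp.integrable.const_mul n)).pos_part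
  have hlim : Tendsto (fun n : ℕ => ∫ y, max (q y - n * p y) 0) atTop (𝓝 0) := by
    have := tendsto_integral_of_dominated_convergence (μ := volume)
      (F := fun (n : ℕ) y => max (q y - n * p y) 0) (f := fun _ => (0 : ℝ)) q
      (fun n => (hint n).aestronglyMeasurable) hq.integrable
      (fun n => ae_of_all _ fun y => by
        rw [Real.norm_of_nonneg (le_max_right _ _)]
        have : 0 ≤ (n : ℝ) * p y := mul_nonneg n.cast_nonneg (hp.nonneg y)
        exact max_le (by linarith) (hq.nonneg y))
      (by
        filter_upwards [hq0] with y hy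
        rcases (hp.nonneg y).eq_or_lt with h0 | hpos
        · simp [← h0, hy h0.symm]
        · refine tendsto_const_nhds.congr' ?_
          obtain ⟨N, hN⟩ := exists_nat_ge (q y / p y)
          filter_upwards [eventually_ge_atTop N] with n hn
          have : q y / p y ≤ n := hN.trans (by exact_mod_cast hn)
          rw [div_le_iff₀ hpos] at this
          exact (max_eq_right (by linarith)).symm)
    simpa using this
  obtain ⟨K, hK⟩ := (hlim.eventually_lt_const (half_pos hε)).exists
  have hK0 : (0 : ℝ) ≤ K := K.cast_nonneg
  refine ⟨min 1 (ε / (2 * (K + 1))), by positivity, min_le_left _ _,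
    le_tradeoff (by positivity) fun g hg hgδ => ?_⟩
  rw [typeIError, integral_densityMeasure hp] at hgδ
  rw [typeIIError_densityMeasure hq hg]
  have hgp := hg.integrable_mul hp.integrable
  have h1 : ∫ y, g y * q y ≤ ∫ y, (max (q y - K * p y) 0 + K * (g y * p y)) := by
    refine integral_mono (hg.integrable_mul hq.integrable)
      ((hint K).add (hgp.const_mul _)) fun y => ?_
    have h2 : g y * (q y - K * p y) ≤ g y * max (q y - K * p y) 0 :=
      mul_le_mul_of_nonneg_left (le_max_left _ _) (hg.nonneg y)
    have h3 : g y * max (q y - K * p y) 0 ≤ max (q y - K * p y) 0 :=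
      mul_le_of_le_one_left (le_max_right _ _) (hg.le_one y)
    simp only
    linarith
  rw [integral_add (hint K) (hgp.const_mul _), integral_const_mul] at h1
  have h4 : (K : ℝ) * ∫ y, g y * p y ≤ ε / 2 :=
    calc (K : ℝ) * ∫ y, g y * p y ≤ K * (ε / (2 * (K + 1))) :=
          mul_le_mul_of_nonneg_left (hgδ.trans (min_le_right _ _)) hK0
      _ ≤ ε / 2 := by
          rw [mul_div_assoc', div_le_div_iff₀ (by positivity) two_pos]
          nlinarith
  linarith

/-! ### The perturbed likelihood-ratio test as a randomized test -/

/-- The perturbed likelihood-ratio test as a test function: the probability, over `x` uniform on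
`[-h/2, h/2]`, that the likelihood ratio at `y` exceeds `η + x`. -/
noncomputable def perturbedTest {d : ℕ} (p q : Rd d → ℝ) (h η : ℝ) (y : Rd d) : ℝ :=
  ∫ x in Set.Icc (-h / 2) (h / 2), (1 / h) * (rejectionRegion p q (η + x)).indicator 1 y

theorem setIntegral_Icc_inv {h : ℝ} (hh : 0 < h) :
    ∫ _ in Set.Icc (-h / 2) (h / 2), 1 / h = 1 := by
  rw [setIntegral_const, Measure.real, Real.volume_Icc, ENNReal.toReal_ofReal (by linarith),
    smul_eq_mul]
  field_simp
  ring

theorem integrable_prod_indicator_rejectionRegion {d : ℕ} {p q f : Rd d → ℝ}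
    (hp : IsContinuousDensity p) (hq : IsContinuousDensity q) (hf : Integrable f) (h η : ℝ) :
    Integrable (fun z : ℝ × Rd d =>
      (1 / h) * (rejectionRegion p q (η + z.1)).indicator 1 z.2 * f z.2)
      ((volume.restrict (Set.Icc (-h / 2) (h / 2))).prod volume) := by
  have hset : MeasurableSet {z : ℝ × Rd d | z.2 ∈ rejectionRegion p q (η + z.1)} :=
    measurableSet_lt ((measurable_const.add measurable_fst).coe_real_ereal)
      ((measurable_likelihoodRatio hp hq).coe_ereal_ennreal.comp measurable_snd)
  have hconst : Integrable (fun _ : ℝ => 1 / h) (volume.restrict (Set.Icc (-h / 2) (h / 2))) :=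
    integrable_const _
  have h2 := (hconst.mul_prod hf).indicator hset
  refine h2.congr (ae_of_all _ fun z => ?_)
  by_cases hz : z.2 ∈ rejectionRegion p q (η + z.1)
  · have hz' : z ∈ {z : ℝ × Rd d | z.2 ∈ rejectionRegion p q (η + z.1)} := hz
    simp [Set.indicator_of_mem hz, Set.indicator_of_mem hz']
  · have hz' : z ∉ {z : ℝ × Rd d | z.2 ∈ rejectionRegion p q (η + z.1)} := hz
    simp [Set.indicator_of_notMem hz, Set.indicator_of_notMem hz']

/-- Integrating out the randomization of the threshold before or after the observation gives the
same rejection probability. -/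
theorem integral_perturbedTest_mul {d : ℕ} {p q f : Rd d → ℝ}
    (hp : IsContinuousDensity p) (hq : IsContinuousDensity q) (hf : Integrable f) (h η : ℝ) :
    ∫ y, perturbedTest p q h η y * f y =
      ∫ x in Set.Icc (-h / 2) (h / 2), (1 / h) * ∫ y in rejectionRegion p q (η + x), f y := by
  simp_rw [perturbedTest, ← integral_mul_const]
  rw [← integral_integral_swap (integrable_prod_indicator_rejectionRegion hp hq hf h η)]
  refine integral_congr_ae (ae_of_all _ fun x => ?_)
  simp only
  simp_rw [mul_assoc]
  rw [integral_const_mul, ← integral_indicator (measurableSet_rejectionRegion hp hq _)]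
  congr 2 with y
  by_cases hy : y ∈ rejectionRegion p q (η + x) <;> simp [hy]

theorem perturbedTest_eq_one {d : ℕ} {p q : Rd d → ℝ} {h η : ℝ} (hh : 0 < h) {y : Rd d}
    (hy : y ∈ rejectionRegion p q (η + h / 2)) : perturbedTest p q h η y = 1 := by
  refine (setIntegral_congr_fun measurableSet_Icc fun x hx => ?_).trans (setIntegral_Icc_inv hh)
  have := rejectionRegion_anti p q (show η + x ≤ η + h / 2 by linarith [hx.2]) hy
  simp [this]

theorem perturbedTest_eq_zero {d : ℕ} {p q : Rd d → ℝ} {h η : ℝ} {y : Rd d}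
    (hy : y ∉ rejectionRegion p q (η - h / 2)) : perturbedTest p q h η y = 0 := by
  refine setIntegral_eq_zero_of_forall_eq_zero fun x hx => ?_
  have : y ∉ rejectionRegion p q (η + x) := fun h' =>
    hy (rejectionRegion_anti p q (by linarith [hx.1]) h')
  simp [this]

theorem integrableOn_indicator_rejectionRegion {d : ℕ} (p q : Rd d → ℝ) (h η : ℝ)
    (y : Rd d) :
    IntegrableOn (fun x => (1 / h) * (rejectionRegion p q (η + x)).indicator (1 : Rd d → ℝ) y)
      (Set.Icc (-h / 2) (h / 2)) := by
  have : Antitone fun x => (rejectionRegion p q (η + x)).indicator (1 : Rd d → ℝ) y :=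
    fun a b hab => Set.indicator_le_indicator_of_subset
      (rejectionRegion_anti p q (by linarith)) (fun _ => zero_le_one) y
  exact ((this.antitoneOn _).integrableOn_isCompact isCompact_Icc).const_mul _

theorem isRandomizedTest_perturbedTest {d : ℕ} {p q : Rd d → ℝ} (hp : IsContinuousDensity p)
    (hq : IsContinuousDensity q) {h : ℝ} (hh : 0 < h) (η : ℝ) :
    IsRandomizedTest (perturbedTest p q h η) where
  measurable := by
    have hset : MeasurableSet {z : Rd d × ℝ | z.1 ∈ rejectionRegion p q (η + z.2)} :=
      measurableSet_lt ((measurable_const.add measurable_snd).coe_real_ereal)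
        ((measurable_likelihoodRatio hp hq).coe_ereal_ennreal.comp measurable_fst)
    have hm : Measurable fun z : Rd d × ℝ =>
        (1 / h) * {z : Rd d × ℝ | z.1 ∈ rejectionRegion p q (η + z.2)}.indicator 1 z :=
      (measurable_one.indicator hset).const_mul _
    exact (hm.stronglyMeasurable.integral_prod_right
      (ν := volume.restrict (Set.Icc (-h / 2) (h / 2)))).measurable
  nonneg y := by
    refine integral_nonneg fun x => mul_nonneg (by positivity) ?_
    exact Set.indicator_nonneg (fun _ _ => zero_le_one) y
  le_one y := by
    rw [← setIntegral_Icc_inv hh]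
    refine integral_mono (integrableOn_indicator_rejectionRegion p q h η y)
      (integrable_const _) fun x => ?_
    refine mul_le_of_le_one_right (by positivity) ?_
    exact Set.indicator_le_self' (fun _ _ => zero_le_one) y

theorem perturbedAlpha_eq_integral {d : ℕ} {p q : Rd d → ℝ} (hp : IsContinuousDensity p)
    (hq : IsContinuousDensity q) (h η : ℝ) :
    perturbedAlpha p q h η = ∫ y, perturbedTest p q h η y * p y :=
  (integral_perturbedTest_mul hp hq hp.integrable h η).symm

theorem perturbedBeta_eq_integral {d : ℕ} {p q : Rd d → ℝ} (hp : IsContinuousDensity p)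
    (hq : IsContinuousDensity q) {h : ℝ} (hh : 0 < h) (η : ℝ) :
    perturbedBeta p q h η = 1 - ∫ y, perturbedTest p q h η y * q y := by
  have h1 : ∀ x, (1 / h) * ∫ y in acceptanceRegion p q (η + x), q y =
      1 / h - (1 / h) * ∫ y in rejectionRegion p q (η + x), q y := fun x => by
    have := integral_add_compl (measurableSet_rejectionRegion hp hq (η + x)) hq.integrable
    rw [hq.integral_eq_one] at this
    rw [acceptanceRegion_eq_compl, eq_sub_iff_add_eq'.2 this]
    ring
  have h2 : IntegrableOn (fun x => (1 / h) * ∫ y in rejectionRegion p q (η + x), q y)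
      (Set.Icc (-h / 2) (h / 2)) := by
    have : Antitone fun x => ∫ y in rejectionRegion p q (η + x), q y := fun a b hab =>
      setIntegral_mono_set hq.integrable.integrableOn (ae_of_all _ hq.nonneg)
        (rejectionRegion_anti p q (by linarith)).eventuallyLE
    exact ((this.antitoneOn _).integrableOn_isCompact isCompact_Icc).const_mul _
  rw [integral_perturbedTest_mul hp hq hq.integrable, perturbedBeta]
  simp_rw [h1]
  rw [integral_sub (integrable_const _) h2, setIntegral_Icc_inv hh]

theorem perturbedBeta_mono {d : ℕ} {p q : Rd d → ℝ} (hq : IsContinuousDensity q) {h : ℝ}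
    (hh : 0 < h) : Monotone (perturbedBeta p q h) := fun η η' hη =>
  integral_mono (integrableOn_acceptance hq h η) (integrableOn_acceptance hq h η') fun x =>
    mul_le_mul_of_nonneg_left
      (monotone_setIntegral_acceptanceRegion (p := p) hq (by linarith)) (by positivity)

theorem perturbedBeta_le_one {d : ℕ} {p q : Rd d → ℝ} (hp : IsContinuousDensity p)
    (hq : IsContinuousDensity q) {h : ℝ} (hh : 0 < h) (η : ℝ) : perturbedBeta p q h η ≤ 1 := by
  rw [perturbedBeta_eq_integral hp hq hh]
  linarith [(isRandomizedTest_perturbedTest hp hq hh η).integral_mul_nonneg hq]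

/-! ### Near-optimality of the perturbed test -/

/-- Where `p` and `q` do not both vanish, the rejection region is `{q > t p}`. -/
theorem mem_rejectionRegion_iff {d : ℕ} {p q : Rd d → ℝ} {y : Rd d} (hp : 0 ≤ p y)
    (hq : 0 ≤ q y) (hpq : 0 < p y ∨ 0 < q y) (t : ℝ) :
    y ∈ rejectionRegion p q t ↔ t * p y < q y := by
  rcases hp.eq_or_lt with h0 | hpos
  · have hqpos : 0 < q y := hpq.resolve_left (by simp [← h0])
    have : likelihoodRatio p q y = ⊤ := by
      simp [likelihoodRatio, ← h0, ENNReal.div_zero, hqpos]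
    simp [rejectionRegion, this, ← h0, hqpos]
  · have : likelihoodRatio p q y = ENNReal.ofReal (q y / p y) := by
      rw [likelihoodRatio, ENNReal.ofReal_div_of_pos hpos]
    rw [rejectionRegion, Set.mem_ofPred_eq, this, EReal.coe_ennreal_ofReal,
      max_eq_left (by positivity), EReal.coe_lt_coe_iff, lt_div_iff₀ hpos]

/-- The perturbed test rejects, up to an error of order `h`, exactly where `q - η p` is positive;
hence no test does better pointwise by more than `(h / 2) p`. -/
theorem sub_perturbedTest_mul_le {d : ℕ} {p q g : Rd d → ℝ} (hp : IsContinuousDensity p)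
    (hq : IsContinuousDensity q) (hg : IsRandomizedTest g) {h : ℝ} (hh : 0 < h) (η : ℝ)
    (y : Rd d) : (g y - perturbedTest p q h η y) * (q y - η * p y) ≤ h / 2 * p y := by
  have hp0 := hp.nonneg y
  have hq0 := hq.nonneg y
  have hR : 0 ≤ h / 2 * p y := by positivity
  by_cases hpq : 0 < p y ∨ 0 < q y
  · have hg0 := hg.nonneg y
    have hg1 := hg.le_one y
    by_cases h1 : y ∈ rejectionRegion p q (η + h / 2)
    · rw [perturbedTest_eq_one hh h1]
      rw [mem_rejectionRegion_iff hp0 hq0 hpq] at h1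
      nlinarith
    by_cases h2 : y ∈ rejectionRegion p q (η - h / 2)
    · have ht := isRandomizedTest_perturbedTest hp hq hh η
      rw [mem_rejectionRegion_iff hp0 hq0 hpq] at h1 h2
      have ha : |g y - perturbedTest p q h η y| ≤ 1 :=
        abs_le.2 ⟨by linarith [ht.le_one y], by linarith [ht.nonneg y]⟩
      have hb : |q y - η * p y| ≤ h / 2 * p y := abs_le.2 ⟨by linarith, by linarith⟩
      calc _ ≤ |g y - perturbedTest p q h η y| * |q y - η * p y| := by
            rw [← abs_mul]; exact le_abs_self _
        _ ≤ 1 * (h / 2 * p y) := mul_le_mul ha hb (abs_nonneg _) zero_le_one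
        _ = _ := one_mul _
    · rw [perturbedTest_eq_zero h2]
      rw [mem_rejectionRegion_iff hp0 hq0 hpq] at h2
      nlinarith
  · push Not at hpq
    have e1 : p y = 0 := le_antisymm hpq.1 hp0
    have e2 : q y = 0 := le_antisymm hpq.2 hq0
    simp [e1, e2]

/-- The perturbed test with threshold `η` minimizes the weighted error
`type-II + η * type-I` up to `h / 2`. -/
theorem perturbedBeta_add_le {d : ℕ} {p q g : Rd d → ℝ} (hp : IsContinuousDensity p)
    (hq : IsContinuousDensity q) (hg : IsRandomizedTest g) {h : ℝ} (hh : 0 < h) (η : ℝ) :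
    perturbedBeta p q h η + η * perturbedAlpha p q h η ≤
      1 - (∫ y, g y * q y) + η * (∫ y, g y * p y) + h / 2 := by
  have ht := isRandomizedTest_perturbedTest hp hq hh η
  have i1 := hg.integrable_mul hq.integrable
  have i2 := hg.integrable_mul hp.integrable
  have i3 := ht.integrable_mul hq.integrable
  have i4 := ht.integrable_mul hp.integrable
  have i5 : Integrable fun y => g y * q y - η * (g y * p y) := i1.sub (i2.const_mul η)
  have i6 : Integrable fun y =>
      perturbedTest p q h η y * q y - η * (perturbedTest p q h η y * p y) :=
    i3.sub (i4.const_mul η)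
  have key : ∫ y, ((g y * q y - η * (g y * p y)) -
      (perturbedTest p q h η y * q y - η * (perturbedTest p q h η y * p y))) ≤
      ∫ y, h / 2 * p y := by
    refine integral_mono (i5.sub i6) (hp.integrable.const_mul _) fun y => ?_
    have := sub_perturbedTest_mul_le hp hq hg hh η y
    simp only
    linarith
  rw [integral_sub i5 i6,
    integral_sub i1 (i2.const_mul η), integral_sub i3 (i4.const_mul η), integral_const_mul,
    integral_const_mul, integral_const_mul, hp.integral_eq_one] at key
  rw [perturbedBeta_eq_integral hp hq hh, perturbedAlpha_eq_integral hp hq]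
  linarith

/-- Markov's inequality for the likelihood ratio: large thresholds have small type-I error. -/
theorem sub_mul_perturbedAlpha_le_one {d : ℕ} {p q : Rd d → ℝ} (hp : IsContinuousDensity p)
    (hq : IsContinuousDensity q) {h : ℝ} (hh : 0 < h) (η : ℝ) :
    (η - h / 2) * perturbedAlpha p q h η ≤ 1 := by
  have ht := isRandomizedTest_perturbedTest hp hq hh η
  rw [perturbedAlpha_eq_integral hp hq, ← integral_const_mul, ← hq.integral_eq_one]
  refine integral_mono ((ht.integrable_mul hp.integrable).const_mul _) hq.integrable fun y => ?_
  have hp0 := hp.nonneg y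
  have hq0 := hq.nonneg y
  have ht0 := ht.nonneg y
  have ht1 := ht.le_one y
  simp only
  by_cases hpq : 0 < p y ∨ 0 < q y
  · by_cases h2 : y ∈ rejectionRegion p q (η - h / 2)
    · rw [mem_rejectionRegion_iff hp0 hq0 hpq] at h2
      nlinarith
    · simpa [perturbedTest_eq_zero h2] using hq0
  · push Not at hpq
    simpa [le_antisymm hpq.1 hp0] using hq0

/-! ### The perturbed trade-off curve -/

theorem continuous_perturbedAlpha {d : ℕ} {p q : Rd d → ℝ} (hp : IsContinuousDensity p) {h : ℝ}
    (hh : 0 < h) : Continuous (perturbedAlpha p q h) := by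
  set F : ℝ → ℝ := fun t => (1 / h) * ∫ y in rejectionRegion p q t, p y with hF
  have hFi : ∀ a b, IntervalIntegrable F volume a b := fun a b =>
    ((antitone_setIntegral_rejectionRegion (q := q) hp).intervalIntegrable).const_mul _
  have heq : perturbedAlpha p q h =
      fun η => (∫ t in (0 : ℝ)..(η + h / 2), F t) - ∫ t in (0 : ℝ)..(η + -h / 2), F t := by
    ext η
    rw [intervalIntegral.integral_interval_sub_left (hFi _ _) (hFi _ _), perturbedAlpha,
      integral_Icc_eq_integral_Ioc, ← intervalIntegral.integral_of_le (by linarith)]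
    exact intervalIntegral.integral_comp_add_left (fun t => F t) η
  rw [heq]
  have := intervalIntegral.continuous_primitive hFi 0
  exact (this.comp (continuous_id.add continuous_const)).sub
    (this.comp (continuous_id.add continuous_const))

theorem perturbedAlpha_eq_one {d : ℕ} {p q : Rd d → ℝ} (hp : IsContinuousDensity p)
    (hq : IsContinuousDensity q) {h η : ℝ} (hh : 0 < h) (hη : η < -h / 2) :
    perturbedAlpha p q h η = 1 := by
  have h1 : ∀ y, perturbedTest p q h η y = 1 := fun y => by
    refine perturbedTest_eq_one hh (lt_of_lt_of_le ?_ (EReal.coe_ennreal_nonneg _))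
    exact_mod_cast (by linarith : η + h / 2 < 0)
  rw [perturbedAlpha_eq_integral hp hq]
  simp [h1, hp.integral_eq_one]

theorem exists_perturbedAlpha_eq {d : ℕ} {p q : Rd d → ℝ} (hp : IsContinuousDensity p)
    (hq : IsContinuousDensity q) {h α : ℝ} (hh : 0 < h) (hα : 0 < α) (hα1 : α ≤ 1) :
    ∃ η, perturbedAlpha p q h η = α := by
  refine mem_range_of_exists_le_of_exists_ge (continuous_perturbedAlpha hp hh)
    ⟨1 / α + h / 2, ?_⟩ ⟨-h / 2 - 1, ?_⟩
  · have := sub_mul_perturbedAlpha_le_one hp hq hh (1 / α + h / 2)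
    rw [add_sub_cancel_right, one_div_mul_eq_div, div_le_one hα] at this
    exact this
  · rw [perturbedAlpha_eq_one hp hq hh (by linarith)]
    exact hα1

theorem perturbedTradeoff_le {d : ℕ} {p q : Rd d → ℝ} (hp : IsContinuousDensity p)
    (hq : IsContinuousDensity q) {h α c : ℝ} (hh : 0 < h) (hα1 : α ≤ 1)
    (hc : ∀ η, α ≤ perturbedAlpha p q h η → perturbedBeta p q h η ≤ c) :
    perturbedTradeoff p q h α ≤ c := by
  refine csSup_le ⟨_, -h / 2 - 1, ?_, rfl⟩ ?_
  · rwa [perturbedAlpha_eq_one hp hq hh (by linarith)]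
  · rintro b ⟨η, hη, rfl⟩
    exact hc η hη

theorem perturbedTradeoff_anti {d : ℕ} {p q : Rd d → ℝ} (hp : IsContinuousDensity p)
    (hq : IsContinuousDensity q) {h α α' : ℝ} (hh : 0 < h) (hαα' : α ≤ α') (hα1 : α' ≤ 1) :
    perturbedTradeoff p q h α' ≤ perturbedTradeoff p q h α := by
  refine perturbedTradeoff_le hp hq hh hα1 fun η hη => le_csSup ⟨1, ?_⟩ ⟨η, hαα'.trans hη, rfl⟩
  rintro b ⟨η', -, rfl⟩
  exact perturbedBeta_le_one hp hq hh η'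

/-! ### Comparison of the two curves -/

/-- On `[δ, 1]` the perturbed curve of `(p', q')` lies above the optimal curve of `(p, q)`, up to
the `L¹`-errors, because the perturbed test is also a test of `P` against `Q`. -/
theorem tradeoff_le_perturbedTradeoff_add {d : ℕ} {p q p' q' : Rd d → ℝ}
    (hp : IsContinuousDensity p) (hq : IsContinuousDensity q) (hp' : IsContinuousDensity p')
    (hq' : IsContinuousDensity q') {h α δ : ℝ} (hh : 0 < h) (hδ : 0 < δ) (hδα : δ ≤ α)
    (hα1 : α ≤ 1) :
    tradeoff (densityMeasure p) (densityMeasure q) α ≤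
      perturbedTradeoff p' q' h α + (∫ y, |q' y - q y|) + (∫ y, |p' y - p y|) / δ := by
  obtain ⟨η, rfl⟩ := exists_perturbedAlpha_eq hp' hq' hh (hδ.trans_le hδα) hα1
  have ht := isRandomizedTest_perturbedTest hp' hq' hh η
  have h1 := abs_le.1 (ht.abs_integral_mul_sub_le hp hp')
  have h2 := abs_le.1 (ht.abs_integral_mul_sub_le hq hq')
  rw [perturbedTradeoff_perturbedAlpha hp' hq' hh, perturbedBeta_eq_integral hp' hq' hh]
  have h3 := tradeoff_le_of_integral_le (e := ∫ y, |p' y - p y|) hp hq ht hδ hδα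
    (integral_nonneg fun _ => abs_nonneg _)
    (by rw [perturbedAlpha_eq_integral hp' hq']; linarith)
  linarith

/-- On `[δ, 1]` the perturbed curve of `(p', q')` lies below the optimal curve of `(p, q)`, up to
the `L¹`-errors and `h`: the perturbed test nearly minimizes `type-II + η * type-I`, and the
multipliers `η` that occur are bounded by Markov's inequality. -/
theorem perturbedTradeoff_le_tradeoff_add {d : ℕ} {p q p' q' : Rd d → ℝ}
    (hp : IsContinuousDensity p) (hq : IsContinuousDensity q) (hp' : IsContinuousDensity p')
    (hq' : IsContinuousDensity q') {h α δ : ℝ} (hh : 0 < h) (hδ : 0 < δ) (hδα : δ ≤ α)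
    (hα1 : α ≤ 1) :
    perturbedTradeoff p' q' h α ≤ tradeoff (densityMeasure p) (densityMeasure q) α +
      ((∫ y, |q' y - q y|) + (1 / δ + h / 2) * (∫ y, |p' y - p y|) + h / 2) := by
  rw [← sub_le_iff_le_add]
  refine le_tradeoff (hδ.le.trans hδα) fun g hg hgα => ?_
  rw [sub_le_iff_le_add]
  rw [typeIError, integral_densityMeasure hp] at hgα
  rw [typeIIError_densityMeasure hq hg]
  refine perturbedTradeoff_le hp' hq' hh hα1 fun η hη => ?_
  have h1 := abs_le.1 (hg.abs_integral_mul_sub_le hp hp')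
  have h2 := abs_le.1 (hg.abs_integral_mul_sub_le hq hq')
  have he : 0 ≤ ∫ y, |p' y - p y| := integral_nonneg fun _ => abs_nonneg _
  have hc : 0 ≤ 1 / δ + h / 2 := by positivity
  rcases le_total η 0 with hη0 | hη0
  · -- Below the threshold `0` the type-II error only decreases, and at `0` the multiplier vanishes.
    refine (perturbedBeta_mono hq' hh hη0).trans ?_
    have h3 := perturbedBeta_add_le hp' hq' hg hh 0
    have h4 := mul_nonneg hc he
    linarith
  · have h3 := perturbedBeta_add_le hp' hq' hg hh η
    have h4 : η ≤ 1 / δ + h / 2 := by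
      by_contra! hlt
      have h5 := sub_mul_perturbedAlpha_le_one hp' hq' hh η
      have h6 : 1 / δ * δ < (η - h / 2) * perturbedAlpha p' q' h η :=
        mul_lt_mul (by linarith) (hδα.trans hη) hδ (by have := one_div_pos.2 hδ; linarith)
      rw [one_div_mul_cancel hδ.ne'] at h6
      linarith
    have h7 : η * ∫ y, g y * p' y ≤ η * (perturbedAlpha p' q' h η + ∫ y, |p' y - p y|) :=
      mul_le_mul_of_nonneg_left (by linarith) hη0
    have h8 := mul_le_mul_of_nonneg_right h4 he
    linarith

theorem abs_perturbedTradeoff_sub_tradeoff_le {d : ℕ} {p q p' q' : Rd d → ℝ}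
    (hp : IsContinuousDensity p) (hq : IsContinuousDensity q) (hp' : IsContinuousDensity p')
    (hq' : IsContinuousDensity q') {h α δ : ℝ} (hh : 0 < h) (hδ : 0 < δ) (hδα : δ ≤ α)
    (hα1 : α ≤ 1) :
    |perturbedTradeoff p' q' h α - tradeoff (densityMeasure p) (densityMeasure q) α| ≤
      (∫ y, |q' y - q y|) + (1 / δ + h / 2) * (∫ y, |p' y - p y|) + h / 2 := by
  have he : 0 ≤ ∫ y, |p' y - p y| := integral_nonneg fun _ => abs_nonneg _
  have h1 := tradeoff_le_perturbedTradeoff_add hp hq hp' hq' hh hδ hδα hα1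
  have h2 := perturbedTradeoff_le_tradeoff_add hp hq hp' hq' hh hδ hδα hα1
  have h3 : (1 / δ + h / 2) * (∫ y, |p' y - p y|) =
    (∫ y, |p' y - p y|) / δ + h / 2 * (∫ y, |p' y - p y|) := by ring
  have h4 : 0 ≤ h / 2 * (∫ y, |p' y - p y|) := by positivity
  exact abs_le.2 ⟨by linarith, by linarith⟩

/-- The deterministic form of the convergence on `[δ, 1]`: for large `n`, the curves built from any
densities within uniform distance `a n` of `p` and `q` are `ε`-close to the optimal curve. -/
theorem eventually_abs_perturbedTradeoff_sub_tradeoff_le {d : ℕ} {p q : Rd d → ℝ}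
    (hp : IsContinuousDensity p) (hq : IsContinuousDensity q) {a h : ℕ → ℝ}
    (ha_nonneg : ∀ n, 0 ≤ a n) (ha : Tendsto a atTop (𝓝 0)) (hh_pos : ∀ n, 0 < h n)
    (hh : Tendsto h atTop (𝓝 0)) {δ ε : ℝ} (hδ : 0 < δ) (hε : 0 < ε) :
    ∀ᶠ n in atTop, ∀ p' q' : Rd d → ℝ, IsContinuousDensity p' → IsContinuousDensity q' →
      (∀ y, |p' y - p y| ≤ a n) → (∀ y, |q' y - q y| ≤ a n) → ∀ α, δ ≤ α → α ≤ 1 →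
      |perturbedTradeoff p' q' (h n) α -
        tradeoff (densityMeasure p) (densityMeasure q) α| ≤ ε := by
  have hlim : Tendsto (fun n => 2 * (∫ y, min (q y) (a n)) +
      (1 / δ + h n / 2) * (2 * ∫ y, min (p y) (a n)) + h n / 2) atTop (𝓝 0) := by
    have h1 := (hq.tendsto_integral_min ha_nonneg ha).const_mul 2
    have h2 := (hp.tendsto_integral_min ha_nonneg ha).const_mul 2
    have h3 := (h1.add (((hh.div_const 2).const_add (1 / δ)).mul h2)).add (hh.div_const 2)
    simpa using h3
  filter_upwards [hlim.eventually_lt_const hε] with n hn p' q' hp' hq' hpp hqq α hδα hα1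
  refine (abs_perturbedTradeoff_sub_tradeoff_le hp hq hp' hq' (hh_pos n) hδ hδα hα1).trans ?_
  have h1 := hp.integral_abs_sub_le hp' (ha_nonneg n) hpp
  have h2 := hq.integral_abs_sub_le hq' (ha_nonneg n) hqq
  have hc : 0 ≤ 1 / δ + h n / 2 := by have := hh_pos n; positivity
  have h3 := mul_le_mul_of_nonneg_left h1 hc
  linarith

/-- The deterministic form of the convergence on `[0, 1]` if `Q ≪ P`: near `0` both monotone curves
are squeezed between their values at a small `δ` and `1`. -/
theorem eventually_abs_perturbedTradeoff_sub_tradeoff_le_of_absolutelyContinuous {d : ℕ}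
    {p q : Rd d → ℝ} (hp : IsContinuousDensity p) (hq : IsContinuousDensity q)
    (hac : densityMeasure q ≪ densityMeasure p) {a h : ℕ → ℝ}
    (ha_nonneg : ∀ n, 0 ≤ a n) (ha : Tendsto a atTop (𝓝 0)) (hh_pos : ∀ n, 0 < h n)
    (hh : Tendsto h atTop (𝓝 0)) {ε : ℝ} (hε : 0 < ε) :
    ∀ᶠ n in atTop, ∀ p' q' : Rd d → ℝ, IsContinuousDensity p' → IsContinuousDensity q' →
      (∀ y, |p' y - p y| ≤ a n) → (∀ y, |q' y - q y| ≤ a n) → ∀ α, 0 ≤ α → α ≤ 1 →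
      |perturbedTradeoff p' q' (h n) α -
        tradeoff (densityMeasure p) (densityMeasure q) α| ≤ ε := by
  obtain ⟨δ, hδ, hδ1, hTδ⟩ := exists_one_sub_le_tradeoff hp hq hac (half_pos hε)
  filter_upwards [eventually_abs_perturbedTradeoff_sub_tradeoff_le hp hq ha_nonneg ha hh_pos hh hδ
    (half_pos hε)] with n hn p' q' hp' hq' hpp hqq α hα hα1
  have hn' := hn p' q' hp' hq' hpp hqq
  rcases le_total δ α with hδα | hδα
  · exact (hn' α hδα hα1).trans (by linarith)
  · have h1 := abs_le.1 (hn' δ le_rfl hδ1)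
    have h2 := perturbedTradeoff_anti hp' hq' (hh_pos n) hδα hδ1
    have h3 : perturbedTradeoff p' q' (h n) α ≤ 1 :=
      perturbedTradeoff_le hp' hq' (hh_pos n) hα1 fun η _ =>
        perturbedBeta_le_one hp' hq' (hh_pos n) η
    have h4 := tradeoff_le_one (p := p) hq hα
    have h5 : tradeoff (densityMeasure p) (densityMeasure q) δ ≤
        tradeoff (densityMeasure p) (densityMeasure q) α :=
      le_tradeoff hα fun g hg hgα => tradeoff_le_typeIIError hg (hgα.trans hδα)
    exact abs_le.2 ⟨by linarith, by linarith⟩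

/-! ### Convergence in probability -/

/-- A deterministic bound on the events where two error terms are at most `a n` turns into
convergence in probability. -/
theorem isLittleOInProbability_iSup_of_eventually {Ω Y ι : Type*} [MeasurableSpace Ω]
    {Pr : Measure Ω} {u v : ℕ → Ω → Y → ℝ} {w : ℕ → Ω → ι → ℝ} {a : ℕ → ℝ}
    (ha_nonneg : ∀ n, 0 ≤ a n)
    (hu : Tendsto (fun n => Pr {ω | ENNReal.ofReal (a n) < ⨆ y, ‖u n ω y‖ₑ}) atTop (𝓝 0))
    (hv : Tendsto (fun n => Pr {ω | ENNReal.ofReal (a n) < ⨆ y, ‖v n ω y‖ₑ}) atTop (𝓝 0))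
    (hw : ∀ ε, 0 < ε → ∀ᶠ n in atTop, ∀ ω, (∀ y, |u n ω y| ≤ a n) → (∀ y, |v n ω y| ≤ a n) →
      ∀ i, |w n ω i| ≤ ε) :
    IsLittleOInProbability Pr fun n ω => ⨆ i, ‖w n ω i‖ₑ := by
  have hle : ∀ {n : ℕ} {f : Y → ℝ}, ¬ENNReal.ofReal (a n) < ⨆ y, ‖f y‖ₑ → ∀ y, |f y| ≤ a n := by
    intro n f hf y
    have := (le_iSup (fun y => ‖f y‖ₑ) y).trans (not_lt.1 hf)
    rwa [Real.enorm_eq_ofReal_abs, ENNReal.ofReal_le_ofReal_iff (ha_nonneg n)] at this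
  intro ε hε
  refine tendsto_of_tendsto_of_tendsto_of_le_of_le' tendsto_const_nhds
    (by simpa using hu.add hv) (Eventually.of_forall fun _ => zero_le) ?_
  filter_upwards [hw ε hε] with n hn
  refine (measure_mono fun ω hω => ?_).trans (measure_union_le _ _)
  by_contra hnot
  rw [Set.mem_union, not_or] at hnot
  refine not_le.2 hω.out (iSup_le fun i => ?_ : ⨆ i, ‖w n ω i‖ₑ ≤ _)
  rw [Real.enorm_eq_ofReal_abs]
  exact ENNReal.ofReal_le_ofReal (hn ω (hle hnot.1) (hle hnot.2) i)

theorem mainTheorem1 {d : ℕ} {Ω : Type*} [MeasurableSpace Ω]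
    (Pr : Measure Ω) [IsProbabilityMeasure Pr]
    -- the densities: continuous, with finitely many levels of positive mass
    (p q : Rd d → ℝ) (hp : IsContinuousDensity p) (hq : IsContinuousDensity q)
    (hlevel : {η : ℝ≥0 | densityMeasure p {y | likelihoodRatio p q y = η} ≠ 0}.Finite)
    -- the estimators: continuous densities that vanish at infinity
    (p_hat q_hat : ℕ → Ω → Rd d → ℝ)
    (hp_hat : ∀ n ω, IsContinuousDensity (p_hat n ω))
    (hq_hat : ∀ n ω, IsContinuousDensity (q_hat n ω))
    (hp_decay : ∀ n ω, Tendsto (p_hat n ω) (cocompact (Rd d)) (𝓝 0))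
    (hq_decay : ∀ n ω, Tendsto (q_hat n ω) (cocompact (Rd d)) (𝓝 0))
    -- uniform convergence at rate `a n`, in probability
    (a : ℕ → ℝ) (ha_nonneg : ∀ n, 0 ≤ a n) (ha : Tendsto a atTop (𝓝 0))
    (hp_rate : Tendsto (fun n => Pr {ω | ENNReal.ofReal (a n) < ⨆ y, ‖p_hat n ω y - p y‖ₑ})
      atTop (𝓝 0))
    (hq_rate : Tendsto (fun n => Pr {ω | ENNReal.ofReal (a n) < ⨆ y, ‖q_hat n ω y - q y‖ₑ})
      atTop (𝓝 0))
    -- `h n → 0` and `h n / a n → ∞` (the quotient is `∞` if `a n = 0`)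
    (h : ℕ → ℝ) (hh_pos : ∀ n, 0 < h n) (hh : Tendsto h atTop (𝓝 0))
    (hh_rate : Tendsto (fun n => ENNReal.ofReal (h n) / ENNReal.ofReal (a n)) atTop (𝓝 ⊤)) :
    -- uniform convergence on `[0, 1]`, in probability, if the ratio `q / p` is finite `Q`-a.s.
    (densityMeasure q ≪ densityMeasure p →
      IsLittleOInProbability Pr
        (fun n ω => ⨆ α : Set.Icc (0 : ℝ) 1,
          ‖perturbedTradeoff (p_hat n ω) (q_hat n ω) (h n) α -
            tradeoff (densityMeasure p) (densityMeasure q) α‖ₑ)) ∧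
    -- uniform convergence away from `α = 0`, in probability, in general
    (∀ δ : ℝ, 0 < δ →
      IsLittleOInProbability Pr
        (fun n ω => ⨆ α : Set.Icc δ 1,
          ‖perturbedTradeoff (p_hat n ω) (q_hat n ω) (h n) α -
            tradeoff (densityMeasure p) (densityMeasure q) α‖ₑ)) := by
  refine ⟨fun hac => ?_, fun δ hδ => ?_⟩
  · refine isLittleOInProbability_iSup_of_eventually ha_nonneg hp_rate hq_rate fun ε hε => ?_
    filter_upwards [eventually_abs_perturbedTradeoff_sub_tradeoff_le_of_absolutelyContinuous hp hq
      hac ha_nonneg ha hh_pos hh hε] with n hn ω hu hv α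
    exact hn _ _ (hp_hat n ω) (hq_hat n ω) hu hv α α.2.1 α.2.2
  · refine isLittleOInProbability_iSup_of_eventually ha_nonneg hp_rate hq_rate fun ε hε => ?_
    filter_upwards [eventually_abs_perturbedTradeoff_sub_tradeoff_le hp hq ha_nonneg ha hh_pos hh
      hδ hε] with n hn ω hu hv α
    exact hn _ _ (hp_hat n ω) (hq_hat n ω) hu hv α α.2.1 α.2.2
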